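/- All rings are commutative with identity, and "local ring" means a Noetherian ring with exactly one maximal ideal. Let $T$ be a local ring with maximal ideal $M$ that is complete (and separated) in the $M$-adic topology. Then $T$ is the completion of a countable local domain, i.e. there is a countable (finite or countably infinite) local integral domain $(A,\mathfrak{m})$ with $\widehat{A} = \varprojlim_n A/\mathfrak{m}^n \cong T$ as rings, if and only if the following three conditions hold: (i) no integer of $T$ is a zerodivisor, i.e. for every $n \in \mathbb{Z}$ such that $n\cdot 1_T \neq 0$, the element $n \cdot 1_T$ is not a zerodivisor of $T$; (ii) either $M = (0)$ or $M \notin \operatorname{Ass}(T)$, where $\operatorname{Ass}(T)$ is the set of associated primes of $T$ as a $T$-module; (iii) $T/M$ is countable (finite or countably infinite). -/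

import Mathlib

universe u

open IsLocalRing Polynomial

/-! Necessity: `A` is a domain and its completion is flat, so nonzero elements of `A` are regular in
`T`. This covers the integers, and it keeps `M` out of `Ass(T)` unless `A`, hence `T`, is a field.

Sufficiency: a field is its own completion. Otherwise `A` is built inside `T` as a countable subring
with regular nonzero elements, satisfying `IT ∩ A = I` for every ideal `I` of `A` and meeting every
class of `T/M` and, modulo `M ^ 2`, generators of `M`. Contraction makes `A` Noetherian and local;
Nakayama gives `m_A T = M`; then `A` is dense with the induced topology, so `T` is its completion.

The engine is `IsRegularSubring.exists_adjoin`. The new element must avoid countably many sets `f(t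
+ b a) ∈ P` with `P ∈ Ass(T)`. As `P ≠ M`, each is closed with dense complement, so completeness
allows a Baire argument. -/

/-- Over a Noetherian domain, nonzero elements stay regular in every adic completion. -/
theorem algebraMap_adicCompletion_mem_nonZeroDivisors {A : Type*} [CommRing A] [IsNoetherianRing A]
    [IsDomain A] (I : Ideal A) {a : A} (ha : a ≠ 0) :
    algebraMap A (AdicCompletion I A) a ∈ nonZeroDivisors (AdicCompletion I A) := by
  have h : IsSMulRegular (AdicCompletion I A) a :=
    Module.Flat.isSMulRegular_of_nonZeroDivisors (mem_nonZeroDivisors_of_ne_zero ha)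
  refine mem_nonZeroDivisors_iff_right.2 fun x hx ↦ h ?_
  simp only [Algebra.smul_def, mul_zero]
  rw [mul_comm, hx]

/-- The three conditions are necessary for `T` to be the completion of a countable local domain. -/
theorem conditions_of_adicCompletion_equiv {A T : Type*} [CommRing T] [IsLocalRing T]
    [IsNoetherianRing T] [CommRing A] [IsLocalRing A] [IsNoetherianRing A] [IsDomain A]
    [Countable A] (e : AdicCompletion (maximalIdeal A) A ≃+* T) :
    (∀ n : ℤ, (n : T) ≠ 0 → (n : T) ∈ nonZeroDivisors T) ∧
      (maximalIdeal T ≠ ⊥ → maximalIdeal T ∉ associatedPrimes T T) ∧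
        Countable (T ⧸ maximalIdeal T) := by
  let φ : A →+* T := (e : _ →+* T).comp (algebraMap A (AdicCompletion (maximalIdeal A) A))
  have hreg : ∀ a : A, a ≠ 0 → φ a ∈ nonZeroDivisors T := fun a ha ↦ by
    refine mem_nonZeroDivisors_iff_right.2 fun x hx ↦ ?_
    have h := algebraMap_adicCompletion_mem_nonZeroDivisors (maximalIdeal A) ha
    have := (mem_nonZeroDivisors_iff_right.1 h) (e.symm x) (e.injective (by simpa [φ] using hx))
    simpa using this
  let ψ : T →+* A ⧸ maximalIdeal A :=
    (AdicCompletion.evalOneₐ (maximalIdeal A) : _ →+* _).comp e.symm.toRingHom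
  have hψ : Function.Surjective ψ :=
    (AdicCompletion.evalOneₐ_surjective (maximalIdeal A)).comp e.symm.surjective
  have hψφ : ∀ a, ψ (φ a) = Ideal.Quotient.mk _ a := fun a ↦ by
    simp [ψ, φ]
  have hker : RingHom.ker ψ = maximalIdeal T := by
    let := Ideal.Quotient.field (maximalIdeal A)
    exact eq_maximalIdeal (RingHom.ker_isMaximal_of_surjective ψ hψ)
  refine ⟨fun n hn ↦ ?_, fun hM hass ↦ ?_, ?_⟩
  · rw [← map_intCast φ n] at hn ⊢
    exact hreg _ fun h ↦ hn (by rw [h, map_zero])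
  · by_cases hm : maximalIdeal A = ⊥
    -- A field is already complete, so every element of `T` comes from `A`.
    · refine hM (eq_bot_iff.2 fun t ht ↦ ?_)
      rw [← hker, RingHom.mem_ker] at ht
      have : IsPrecomplete (maximalIdeal A) A := by rw [hm]; infer_instance
      obtain ⟨a, ha⟩ := AdicCompletion.of_surjective (maximalIdeal A) A (e.symm t)
      have ht' : t = φ a := by
        rw [← e.apply_symm_apply t, ← ha]; rfl
      rw [ht', hψφ, Ideal.Quotient.eq_zero_iff_mem, hm, Ideal.mem_bot] at ht
      simp [ht', ht]
    · obtain ⟨a, ham, ha⟩ := Submodule.exists_mem_ne_zero_of_ne_bot hm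
      have h1 : φ a ∈ maximalIdeal T := by
        rw [← hker, RingHom.mem_ker, hψφ, Ideal.Quotient.eq_zero_iff_mem]
        exact ham
      have h2 : φ a ∈ (nonZeroDivisors T : Set T)ᶜ := by
        rw [← biUnion_associatedPrimes_eq_compl_nonZeroDivisors]
        exact Set.mem_biUnion hass h1
      exact h2 (hreg a ha)
  · rw [← hker]
    have : Countable (A ⧸ maximalIdeal A) := Ideal.Quotient.mk_surjective.countable
    exact (RingHom.quotientKerEquivOfSurjective hψ).injective.countable

/-! ### Baire avoidance in the adic topology -/

section Avoidance

/-- A Baire-type statement for adic topologies: countably many sets, each of which avoids a whole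
ball near any given point, can be avoided simultaneously inside any power of the ideal. -/
theorem exists_mem_pow_forall_notMem {T ι : Type*} [CommRing T] [Countable ι] (I : Ideal T)
    [IsPrecomplete I T] (B : ι → Set T)
    (hB : ∀ k, ∀ a : T, ∀ n : ℕ, ∃ a', a' - a ∈ I ^ n ∧ ∃ n', ∀ b, b - a' ∈ I ^ n' → b ∉ B k)
    (N : ℕ) : ∃ a ∈ I ^ N, ∀ k, a ∉ B k := by
  rcases isEmpty_or_nonempty ι with h | h
  · exact ⟨0, zero_mem _, fun k ↦ isEmptyElim k⟩
  obtain ⟨ν, hν⟩ := exists_surjective_nat ι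
  choose next h1 rad h2 using hB
  -- Each stage stores a center and a precision. The `+ 1` makes precisions strictly increasing,
  -- hence at least the index, so the centers form a Cauchy sequence.
  let s : ℕ → T × ℕ := fun k ↦ Nat.rec (0, N)
    (fun k p ↦ (next (ν k) p.1 p.2, max (rad (ν k) p.1 p.2) p.2 + 1)) k
  have hs : ∀ k, s (k + 1) =
    (next (ν k) (s k).1 (s k).2, max (rad (ν k) (s k).1 (s k).2) (s k).2 + 1) := fun k ↦ rfl
  have hmono : StrictMono fun k ↦ (s k).2 := strictMono_nat_of_lt_succ fun k ↦ by
    rw [hs]; simp only; omega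
  have hstep : ∀ k, (s (k + 1)).1 - (s k).1 ∈ I ^ (s k).2 := fun k ↦ by
    rw [hs]; exact h1 _ _ _
  have hdiff : ∀ k j, k ≤ j → (s j).1 - (s k).1 ∈ I ^ (s k).2 := fun k j hkj ↦ by
    induction j, hkj using Nat.le_induction with
    | base => simp
    | succ j hkj ih =>
      have := add_mem (Ideal.pow_le_pow_right (hmono.monotone hkj) (hstep j)) ih
      simpa using this
  obtain ⟨L, hL⟩ := IsPrecomplete.prec ‹IsPrecomplete I T› (f := fun k ↦ (s k).1)
    fun {m n} hmn ↦ by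
      rw [SModEq.sub_mem, ← neg_mem_iff, neg_sub, smul_eq_mul, Ideal.mul_top]
      exact Ideal.pow_le_pow_right (hmono.id_le m) (hdiff m n hmn)
  have hLs : ∀ k, L - (s k).1 ∈ I ^ (s k).2 := fun k ↦ by
    have h := hL (max k (s k).2)
    rw [SModEq.sub_mem, ← neg_mem_iff, neg_sub, smul_eq_mul, Ideal.mul_top] at h
    have := add_mem (Ideal.pow_le_pow_right (le_max_right _ _) h) (hdiff k _ (le_max_left k (s k).2))
    simpa using this
  refine ⟨L, by simpa [s] using hLs 0, fun k ↦ ?_⟩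
  obtain ⟨k, rfl⟩ := hν k
  refine h2 (ν k) (s k).1 (s k).2 L ?_
  have := hLs (k + 1)
  rw [hs] at this
  exact Ideal.pow_le_pow_right (by simp only; omega) this

variable {T : Type*} [CommRing T] [IsLocalRing T]

/-- For `y ∈ M \ P`, the points `a + y ^ (n + k)` are pairwise distinct modulo `P`, because `y` is a
nonzero nonunit of the domain `T/P`; a nonzero polynomial cannot vanish at all of them. -/
theorem exists_eval_notMem_of_map_ne_zero {P : Ideal T} [P.IsPrime] (hP : P ≠ maximalIdeal T)
    {g : T[X]} (hg : g.map (Ideal.Quotient.mk P) ≠ 0) (a : T) (n : ℕ) :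
    ∃ a', a' - a ∈ maximalIdeal T ^ n ∧ g.eval a' ∉ P := by
  by_contra! hcon
  obtain ⟨y, hyM, hyP⟩ : ∃ y ∈ maximalIdeal T, y ∉ P := by
    by_contra! h
    exact hP (le_antisymm (le_maximalIdeal Ideal.IsPrime.ne_top') h)
  set π := Ideal.Quotient.mk P
  have hy0 : π y ≠ 0 := fun h ↦ hyP (Ideal.Quotient.eq_zero_iff_mem.1 h)
  have hyu : ¬ IsUnit (π y) := fun hu ↦ by
    have : IsLocalHom π := IsLocalHom.of_surjective π Ideal.Quotient.mk_surjective
    exact (mem_maximalIdeal y).1 hyM (isUnit_of_map_unit π y hu)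
  refine hg (eq_zero_of_infinite_isRoot _ (Set.infinite_of_injective_forall_mem
    (f := fun k : ℕ ↦ π (a + y ^ (n + k))) (fun i j hij ↦ ?_) fun k ↦ ?_))
  · simp only [map_add, map_pow, add_right_inj] at hij
    exact Nat.add_left_cancel (pow_injective_of_not_isUnit hyu hy0 hij)
  · have h := hcon (a + y ^ (n + k)) (by
      rw [add_sub_cancel_left]
      exact Ideal.pow_le_pow_right (Nat.le_add_right n k) (Ideal.pow_mem_pow hyM _))
    rw [Set.mem_ofPred_eq, IsRoot.def, eval_map, eval₂_at_apply]
    exact Ideal.Quotient.eq_zero_iff_mem.2 h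

/-- Ideals are closed, by Krull's intersection theorem in `T/P`. -/
theorem exists_forall_sub_mem_pow_notMem [IsNoetherianRing T] {P : Ideal T} {x : T} (hx : x ∉ P) :
    ∃ n, ∀ z, z - x ∈ maximalIdeal T ^ n → z ∉ P := by
  by_contra! hcon
  have h : Ideal.Quotient.mk P x ∈ (⨅ i : ℕ, maximalIdeal T ^ i • ⊤ : Submodule T (T ⧸ P)) := by
    refine (Submodule.mem_iInf _).2 fun i ↦ ?_
    obtain ⟨z, hz, hzP⟩ := hcon i
    have : Ideal.Quotient.mk P x = (x - z) • (1 : T ⧸ P) := by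
      rw [Algebra.smul_def, mul_one, Ideal.Quotient.algebraMap_eq, map_sub,
        Ideal.Quotient.eq_zero_iff_mem.2 hzP, sub_zero]
    rw [this]
    refine Submodule.smul_mem_smul ?_ trivial
    rwa [← neg_mem_iff, neg_sub]
  rw [Ideal.iInf_pow_smul_eq_bot_of_isLocalRing _ Ideal.IsPrime.ne_top', Submodule.mem_bot,
    Ideal.Quotient.eq_zero_iff_mem] at h
  exact hx h

end Avoidance

/-! ### Countable regular subrings and their enlargements -/

theorem countable_polynomial (R : Type*) [CommRing R] [Countable R] : Countable R[X] := by
  rw [← Cardinal.mk_le_aleph0_iff]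
  exact Polynomial.cardinalMk_le_max.trans (max_le Cardinal.mk_le_aleph0 le_rfl)

/-- A countable subring all of whose nonzero elements are regular in the ambient ring. -/
structure IsRegularSubring {T : Type*} [CommRing T] (R : Subring T) : Prop where
  countable : (R : Set T).Countable
  mem_nonZeroDivisors : ∀ x ∈ R, x ≠ 0 → x ∈ nonZeroDivisors T

namespace IsRegularSubring

section General

variable {T : Type*} [CommRing T]

/-- The element `x` may be algebraic over `R`: only the nonzero values of polynomials at `x` need to
be regular. -/
theorem adjoin {R : Subring T} (hR : IsRegularSubring R) {x : T}
    (hx : ∀ f : R[X], aeval x f ≠ 0 → aeval x f ∈ nonZeroDivisors T) :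
    IsRegularSubring (Algebra.adjoin R {x}).toSubring where
  countable := by
    have : Countable R := hR.countable.to_subtype
    have : Countable R[X] := countable_polynomial R
    have h : ((Algebra.adjoin R {x}).toSubring : Set T) = Set.range (aeval (R := R) x) := by
      ext y
      simp [Algebra.adjoin_singleton_eq_range_aeval]
    rw [h]
    exact Set.countable_range _
  mem_nonZeroDivisors y hy hy0 := by
    rw [Subalgebra.mem_toSubring, Algebra.adjoin_singleton_eq_range_aeval] at hy
    obtain ⟨f, rfl⟩ := hy
    exact hx f hy0

theorem le_adjoin (R : Subring T) (x : T) : R ≤ (Algebra.adjoin R {x}).toSubring :=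
  fun r hr ↦ Subalgebra.algebraMap_mem (Algebra.adjoin R {x}) ⟨r, hr⟩

theorem self_mem_adjoin (R : Subring T) (x : T) : x ∈ (Algebra.adjoin R {x}).toSubring :=
  Algebra.self_mem_adjoin_singleton R x

/-- Adjoining a quotient `c / a` of elements of a regular subring. -/
theorem adjoin_of_mul_mem {R : Subring T} (hR : IsRegularSubring R) {a t : T} (ha : a ∈ R)
    (ha0 : a ≠ 0) (hat : a * t ∈ R) : IsRegularSubring (Algebra.adjoin R {t}).toSubring := by
  -- Powers of `a` clear denominators; a factor of a regular element is regular.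
  have key : ∀ y ∈ Algebra.adjoin R {t}, ∃ d : ℕ, a ^ d * y ∈ R := fun y hy ↦ by
    induction hy using Algebra.adjoin_induction with
    | mem x hx => exact ⟨1, by rw [Set.mem_singleton_iff.1 hx, pow_one]; exact hat⟩
    | algebraMap r => exact ⟨0, by rw [pow_zero, one_mul]; exact r.2⟩
    | add x y _ _ hx hy =>
      obtain ⟨d, hd⟩ := hx
      obtain ⟨e, he⟩ := hy
      refine ⟨d + e, ?_⟩
      have := add_mem (mul_mem (pow_mem ha e) hd) (mul_mem (pow_mem ha d) he)
      convert this using 1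
      ring
    | mul x y _ _ hx hy =>
      obtain ⟨d, hd⟩ := hx
      obtain ⟨e, he⟩ := hy
      refine ⟨d + e, ?_⟩
      have := mul_mem hd he
      convert this using 1
      ring
  refine hR.adjoin fun f hf ↦ ?_
  obtain ⟨d, hd⟩ := key (aeval t f) (aeval_mem_adjoin_singleton R t)
  have hreg := pow_mem (hR.mem_nonZeroDivisors a ha ha0) d
  have h := hR.mem_nonZeroDivisors _ hd fun h ↦ hf ((mem_nonZeroDivisors_iff.1 hreg).1 _ h)
  exact (mul_mem_nonZeroDivisors.1 h).2

theorem iSup_nat {S : ℕ → Subring T} (hS : ∀ n, IsRegularSubring (S n)) (hmono : Monotone S) :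
    IsRegularSubring (⨆ n, S n) where
  countable := by
    rw [Subring.coe_iSup_of_directed hmono.directed_le]
    exact Set.countable_iUnion fun n ↦ (hS n).countable
  mem_nonZeroDivisors x hx := by
    obtain ⟨n, hn⟩ := (Subring.mem_iSup_of_directed hmono.directed_le).1 hx
    exact (hS n).mem_nonZeroDivisors x hn

/-- Countably many monotone requirements, each of which can be met by enlarging a regular
subring, can be met simultaneously. -/
theorem exists_forall_of_countable {ι : Type*} [Countable ι] {R : Subring T}
    (hR : IsRegularSubring R) (p : ι → Subring T → Prop) (hp : ∀ i, Monotone (p i))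
    (hstep : ∀ i, ∀ S, R ≤ S → IsRegularSubring S → ∃ S', S ≤ S' ∧ IsRegularSubring S' ∧ p i S') :
    ∃ S, R ≤ S ∧ IsRegularSubring S ∧ ∀ i, p i S := by
  rcases isEmpty_or_nonempty ι with h | h
  · exact ⟨R, le_rfl, hR, fun i ↦ isEmptyElim i⟩
  obtain ⟨ν, hν⟩ := exists_surjective_nat ι
  choose next hle hreg hnext using hstep
  let X := {S : Subring T // R ≤ S ∧ IsRegularSubring S}
  let s : ℕ → X := fun k ↦ Nat.rec ⟨R, le_rfl, hR⟩ (fun k S ↦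
    ⟨next (ν k) S.1 S.2.1 S.2.2, S.2.1.trans (hle _ _ _ _), hreg _ _ _ _⟩) k
  have hmono : Monotone fun k ↦ (s k).1 := monotone_nat_of_le_succ fun k ↦ hle _ _ _ _
  refine ⟨⨆ k, (s k).1, (s 0).2.1.trans (le_iSup (fun k ↦ (s k).1) 0),
    iSup_nat (fun k ↦ (s k).2.2) hmono, fun i ↦ ?_⟩
  obtain ⟨k, rfl⟩ := hν i
  exact hp _ (le_iSup (fun k ↦ (s k).1) (k + 1)) (hnext (ν k) _ (s k).2.1 (s k).2.2)

theorem span_mono_subring {S S' : Subring T} (h : S ≤ S') (s : Set T) :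
    (Submodule.span S s : Set T) ⊆ Submodule.span S' s := fun x hx ↦ by
  induction hx using Submodule.span_induction with
  | mem x hx => exact Submodule.subset_span hx
  | zero => exact zero_mem _
  | add x y _ _ hx hy => exact add_mem hx hy
  | smul a x _ hx => exact Submodule.smul_mem _ (⟨a, h a.2⟩ : S') hx

end General

variable {T : Type*} [CommRing T] [IsLocalRing T] [IsNoetherianRing T]
  [IsPrecomplete (maximalIdeal T) T]

/-- A regular subring can be enlarged by an element of `t + I ^ N * b` that behaves like a
transcendental one. -/
theorem exists_adjoin (hM : maximalIdeal T ∉ associatedPrimes T T) {R : Subring T}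
    (hR : IsRegularSubring R) (t : T) {b : T} (hb : b ∈ nonZeroDivisors T) (N : ℕ) :
    ∃ a ∈ maximalIdeal T ^ N, IsRegularSubring (Algebra.adjoin R {t + b * a}).toSubring := by
  have : Countable R := hR.countable.to_subtype
  have : Countable R[X] := countable_polynomial R
  have : Countable (associatedPrimes T T) := (associatedPrimes.finite T T).countable.to_subtype
  have hass : ∀ x, x ∈ nonZeroDivisors T → ∀ P ∈ associatedPrimes T T, x ∉ P := by
    intro x hx P hP hxP
    have : x ∈ (nonZeroDivisors T : Set T)ᶜ := by
      rw [← biUnion_associatedPrimes_eq_compl_nonZeroDivisors]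
      exact Set.mem_biUnion hP hxP
    exact this hx
  obtain ⟨a, haN, ha⟩ := exists_mem_pow_forall_notMem
    (ι := {f : R[X] // f ≠ 0} × associatedPrimes T T) (maximalIdeal T)
    (fun k ↦ {a | aeval (t + b * a) k.1.1 ∈ k.2.1}) (fun ⟨⟨f, hf⟩, ⟨P, hP⟩⟩ a n ↦ by
      have hprime : P.IsPrime := IsAssociatedPrime.isPrime hP
      have hPM : P ≠ maximalIdeal T := fun h ↦ hM (h ▸ hP)
      set g : T[X] := (f.map R.subtype).comp (C t + C b * X) with hg
      have hgeval : ∀ a, g.eval a = aeval (t + b * a) f := fun a ↦ by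
        simp [g, eval_comp, eval_map, aeval_def]
        rfl
      -- The polynomial `f` survives modulo `P` because `R ∩ P = 0`, and the inner linear polynomial
      -- is nonconstant there because its slope `b` is regular.
      have hg0 : g.map (Ideal.Quotient.mk P) ≠ 0 := by
        rw [hg, Polynomial.map_comp, Ne, comp_eq_zero_iff, Polynomial.map_map]
        rintro (h | ⟨-, h⟩)
        · refine hf ((Polynomial.map_eq_zero_iff ?_).1 h)
          rw [injective_iff_map_eq_zero]
          intro r hr
          by_contra hr0
          exact hass r (hR.mem_nonZeroDivisors r r.2 (by simpa using hr0)) P hP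
            (Ideal.Quotient.eq_zero_iff_mem.1 hr)
        · have h1 := congrArg (fun q ↦ q.coeff 1) h
          simp [coeff_C] at h1
          exact hass b hb P hP (Ideal.Quotient.eq_zero_iff_mem.1 h1)
      obtain ⟨a', ha', hga'⟩ := exists_eval_notMem_of_map_ne_zero hPM hg0 a n
      obtain ⟨n', hn'⟩ := exists_forall_sub_mem_pow_notMem hga'
      refine ⟨a', ha', n', fun c hc hcP ↦ hn' (g.eval c) ?_ ?_⟩
      · exact Ideal.mem_of_dvd _ (sub_dvd_eval_sub c a' g) hc
      · rw [hgeval]; exact hcP) N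
  refine ⟨a, haN, hR.adjoin fun f hf ↦ ?_⟩
  by_contra hcon
  have h : aeval (t + b * a) f ∈ (nonZeroDivisors T : Set T)ᶜ := hcon
  rw [← biUnion_associatedPrimes_eq_compl_nonZeroDivisors] at h
  obtain ⟨P, hP, hfP⟩ := Set.mem_iUnion₂.1 h
  exact ha (⟨f, fun h ↦ hf (by rw [h, map_zero])⟩, ⟨P, hP⟩) hfP

/-- A regular subring can be enlarged so that a given membership in an extended ideal descends. -/
theorem exists_mem_span (hM : maximalIdeal T ∉ associatedPrimes T T) (s : Finset T) :
    ∀ {R : Subring T}, IsRegularSubring R → (s : Set T) ⊆ R → ∀ c ∈ R, c ∈ Ideal.span (s : Set T) →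
      ∃ S, R ≤ S ∧ IsRegularSubring S ∧ c ∈ Submodule.span S (s : Set T) := by
  classical
  induction s using Finset.induction_on with
  | empty =>
    intro R hR _ c _ hc
    refine ⟨R, le_rfl, hR, ?_⟩
    simpa using hc
  | insert a s _ ih =>
    intro R hR hs c hcR hc
    rw [Finset.coe_insert, Set.insert_subset_iff] at hs
    rw [Finset.coe_insert, Ideal.mem_span_insert] at hc
    obtain ⟨t, z, hz, rfl⟩ := hc
    rw [Finset.coe_insert]
    by_cases hb : ∃ b ∈ s, b ≠ 0
    · obtain ⟨b, hbs, hb0⟩ := hb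
      -- Replacing the coefficient `t` by `t + b * α` changes `c` only by a multiple of `b ∈ s`, so
      -- the remainder stays in the ideal of `s` and induction applies. No closeness to `t` is
      -- needed, hence exponent `0`.
      obtain ⟨α, -, hα⟩ :=
        hR.exists_adjoin hM t (hR.mem_nonZeroDivisors b (hs.2 hbs) hb0) 0
      have hle := le_adjoin R (t + b * α)
      have hmem := self_mem_adjoin R (t + b * α)
      set R' := (Algebra.adjoin R {t + b * α}).toSubring
      obtain ⟨S, hRS, hS, hcS⟩ := ih hα (fun x hx ↦ hle (hs.2 hx))
        (t * a + z - (t + b * α) * a) (sub_mem (hle hcR) (mul_mem hmem (hle hs.1))) (by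
          have : t * a + z - (t + b * α) * a = z - (α * a) * b := by ring
          rw [this]
          exact sub_mem hz (Ideal.mul_mem_left _ _ (Ideal.subset_span hbs)))
      refine ⟨S, hle.trans hRS, hS, Submodule.mem_span_insert.2
        ⟨⟨t + b * α, hRS hmem⟩, _, hcS, ?_⟩⟩
      rw [Subring.smul_def, smul_eq_mul]
      ring
    -- The ideal is now principal, so the coefficient cannot be perturbed; the exact quotient `t = c
    -- / a` is adjoined.
    · push Not at hb
      have hz0 : z = 0 := by
        have : Ideal.span (s : Set T) = ⊥ := Ideal.span_eq_bot.2 fun x hx ↦ hb x hx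
        simpa [this] using hz
      subst hz0
      rw [add_zero] at hcR ⊢
      by_cases ha : a = 0
      · exact ⟨R, le_rfl, hR, by rw [ha, mul_zero]; exact zero_mem _⟩
      · refine ⟨_, le_adjoin R t, hR.adjoin_of_mul_mem hs.1 ha (by rwa [mul_comm]), ?_⟩
        exact Submodule.smul_mem _ (⟨t, self_mem_adjoin R t⟩ : (Algebra.adjoin R {t}).toSubring)
          (Submodule.subset_span (Set.mem_insert a _))

/-- A regular subring can be enlarged to one over which all memberships in extensions of finitely
generated ideals descend. -/
theorem exists_span_closed (hM : maximalIdeal T ∉ associatedPrimes T T) {R : Subring T}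
    (hR : IsRegularSubring R) :
    ∃ S, R ≤ S ∧ IsRegularSubring S ∧ ∀ s : Finset T, (s : Set T) ⊆ S →
      ∀ c ∈ S, c ∈ Ideal.span (s : Set T) → c ∈ Submodule.span S (s : Set T) := by
  classical
  have hone : ∀ R : Subring T, IsRegularSubring R → ∃ S, R ≤ S ∧ IsRegularSubring S ∧
      ∀ s : Finset T, (s : Set T) ⊆ R →
        ∀ c ∈ R, c ∈ Ideal.span (s : Set T) → c ∈ Submodule.span S (s : Set T) := by
    intro R hR
    have : Countable R := hR.countable.to_subtype
    obtain ⟨S, hRS, hS, h⟩ := hR.exists_forall_of_countable (ι := Finset R × R)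
      (fun i S ↦ i.2.1 ∈ Ideal.span ((i.1.image Subtype.val : Finset T) : Set T) →
        i.2.1 ∈ Submodule.span S ((i.1.image Subtype.val : Finset T) : Set T))
      (fun i S S' hSS' h hi ↦ span_mono_subring hSS' _ (h hi))
      (fun i S hRS hS ↦ by
        by_cases hi : i.2.1 ∈ Ideal.span ((i.1.image Subtype.val : Finset T) : Set T)
        · obtain ⟨S', h1, h2, h3⟩ := exists_mem_span hM (i.1.image Subtype.val) hS
            (fun x hx ↦ by
              obtain ⟨y, -, rfl⟩ := Finset.mem_image.1 hx
              exact hRS y.2) _ (hRS i.2.2) hi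
          exact ⟨S', h1, h2, fun _ ↦ h3⟩
        · exact ⟨S, le_rfl, hS, fun h ↦ absurd h hi⟩)
    refine ⟨S, hRS, hS, fun s hs c hc hcs ↦ ?_⟩
    have hsR : s = (s.subtype (· ∈ R)).image Subtype.val := by
      ext x
      simp only [Finset.mem_image, Finset.mem_subtype, Subtype.exists, exists_and_left,
        exists_prop, exists_eq_right_right]
      exact ⟨fun hx ↦ ⟨hx, hs hx⟩, fun hx ↦ hx.1⟩
    have := h (s.subtype (· ∈ R), ⟨c, hc⟩)
    rw [← hsR] at this
    exact this hcs
  choose next hle hreg hnext using hone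
  -- One pass treats only data from the old subring. After countably many passes, any finite set and
  -- element of the union already lie in some stage.
  let s : ℕ → {S : Subring T // IsRegularSubring S} := fun k ↦ Nat.rec ⟨R, hR⟩ (fun _ S ↦
    ⟨next S.1 S.2, hreg _ _⟩) k
  have hmono : Monotone fun k ↦ (s k).1 := monotone_nat_of_le_succ fun k ↦ hle _ _
  have hdir := hmono.directed_le
  refine ⟨⨆ k, (s k).1, le_iSup (fun k ↦ (s k).1) 0, iSup_nat (fun k ↦ (s k).2) hmono,
    fun F hF c hc hcF ↦ ?_⟩
  obtain ⟨k, hk⟩ : ∃ k, ((insert c F : Finset T) : Set T) ⊆ (s k).1 := by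
    refine Directed.exists_mem_subset_of_finset_subset_biUnion
      (f := fun k ↦ ((s k).1 : Set T)) (hdir.mono_comp _ fun _ _ h ↦ h) ?_
    rw [← Subring.coe_iSup_of_directed hdir, Finset.coe_insert, Set.insert_subset_iff]
    exact ⟨hc, hF⟩
  exact span_mono_subring (le_iSup (fun k ↦ (s k).1) (k + 1)) _ (hnext _ _ F
    (fun x hx ↦ hk (by simp [Finset.mem_coe.1 hx])) c (hk (by simp)) hcF)

end IsRegularSubring

/-! ### Recognizing a completion -/

/-- A ring is completed by any complete overring in which it is dense with the induced topology. -/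
theorem nonempty_adicCompletion_equiv {A T : Type*} [CommRing A] [CommRing T] (ι : A →+* T)
    (I : Ideal A) (J : Ideal T) [IsAdicComplete J T] (hc : ∀ n, (J ^ n).comap ι = I ^ n)
    (hd : ∀ n t, ∃ a, ι a - t ∈ J ^ n) : Nonempty (AdicCompletion I A ≃+* T) := by
  let q : ∀ n, A ⧸ I ^ n →+* T ⧸ J ^ n := fun n ↦ Ideal.quotientMap (J ^ n) ι (hc n).ge
  let f : ∀ n, AdicCompletion I A →+* T ⧸ J ^ n := fun n ↦
    (q n).comp (AdicCompletion.evalₐ I n : _ →+* _)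
  have hfmk : ∀ n (x : AdicCompletion.AdicCauchySequence I A),
      f n (AdicCompletion.mk I A x) = Ideal.Quotient.mk _ (ι (x n)) := fun n x ↦ by
    simp [f, q]
  have hf : ∀ {m n : ℕ} (hle : m ≤ n), (Ideal.Quotient.factorPow J hle).comp (f n) = f m := by
    intro m n hle
    ext x
    induction x using AdicCompletion.induction_on with
    | _ x =>
      rw [RingHom.comp_apply, hfmk, hfmk]
      change Ideal.Quotient.mk _ _ = _
      have h := AdicCompletion.Ideal.mk_eq_mk I hle x
      rw [Ideal.Quotient.eq, ← map_sub, ← Ideal.mem_comap, hc]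
      exact Ideal.Quotient.eq.1 h
  let F := IsAdicComplete.liftRingHom J f hf
  have hF : ∀ n x, Ideal.Quotient.mk (J ^ n) (F x) = f n x :=
    IsAdicComplete.mk_liftRingHom J f hf
  refine ⟨RingEquiv.ofBijective F ⟨?_, fun t ↦ ?_⟩⟩
  · rw [injective_iff_map_eq_zero]
    intro x hx
    refine AdicCompletion.ext_evalₐ fun n ↦ ?_
    have h := hF n x
    rw [hx, map_zero] at h
    have hq : Function.Injective (q n) := Ideal.quotientMap_injective' (hc n).le
    rw [map_zero]
    exact hq (h.symm.trans (map_zero _).symm)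
  -- Approximations of `t` are Cauchy in `A` itself, because `J ^ n` contracts to `I ^ n`.
  · choose a ha using fun n ↦ hd n t
    let x : AdicCompletion.AdicCauchySequence I A := AdicCompletion.AdicCauchySequence.mk I A a
      fun n ↦ by
        rw [SModEq.sub_mem, smul_eq_mul, Ideal.mul_top, ← hc, Ideal.mem_comap, map_sub]
        simpa using sub_mem (ha n) (Ideal.pow_le_pow_right n.le_succ (ha (n + 1)))
    refine ⟨AdicCompletion.mk I A x, (IsHausdorff.eq_iff_smodEq (I := J)).2 fun n ↦ ?_⟩
    rw [SModEq.sub_mem, smul_eq_mul, Ideal.mul_top, ← Ideal.Quotient.eq, hF, hfmk,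
      Ideal.Quotient.eq]
    exact ha n

section Contraction

variable {A T : Type*} [CommRing A] [CommRing T] {ι : A →+* T}

/-- Extension of ideals is injective and monotone, so an infinite ascending chain in `A` would give
one in `T`. -/
theorem isNoetherianRing_of_comap_map_eq [IsNoetherianRing T]
    (h : ∀ I : Ideal A, (I.map ι).comap ι = I) : IsNoetherianRing A := by
  have hinj : Function.Injective (Ideal.map ι) := fun I J hIJ ↦ by rw [← h I, hIJ, h J]
  have hmono : StrictMono (Ideal.map ι) :=
    Monotone.strictMono_of_injective (fun _ _ h ↦ Ideal.map_mono h) hinj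
  rw [isNoetherianRing_iff, isNoetherian_iff']
  exact hmono.wellFoundedGT

theorem isLocalHom_of_comap_map_eq (h : ∀ I : Ideal A, (I.map ι).comap ι = I) : IsLocalHom ι where
  map_nonunit u hu := by
    rw [← Ideal.span_singleton_eq_top, ← h (Ideal.span {u}), Ideal.map_span, Set.image_singleton,
      Ideal.span_singleton_eq_top.2 hu, Ideal.comap_top]

/-- Successive approximation: an error in `M ^ n` is a `T`-combination of elements of `m_A ^ n`, and
replacing its coefficients by elements of `A` modulo `M` leaves an error in `M ^ (n + 1)`. -/
theorem exists_sub_mem_maximalIdeal_pow [IsLocalRing A] [IsLocalRing T]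
    (hmap : (maximalIdeal A).map ι = maximalIdeal T) (hd : ∀ t, ∃ a, ι a - t ∈ maximalIdeal T)
    (n : ℕ) (t : T) : ∃ a, ι a - t ∈ maximalIdeal T ^ n := by
  have key : ∀ n, ∀ y ∈ (maximalIdeal A ^ n).map ι,
      ∃ a ∈ maximalIdeal A ^ n, ι a - y ∈ maximalIdeal T ^ (n + 1) := fun n y hy ↦ by
    induction hy using Submodule.span_induction with
    | mem y hy =>
      obtain ⟨a, ha, rfl⟩ := hy
      exact ⟨a, ha, by simp⟩
    | zero => exact ⟨0, zero_mem _, by simp⟩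
    | add y z _ _ hy hz =>
      obtain ⟨a, ha, hay⟩ := hy
      obtain ⟨b, hb, hbz⟩ := hz
      exact ⟨a + b, add_mem ha hb, by simpa [add_sub_add_comm] using add_mem hay hbz⟩
    | smul c y _ hy =>
      obtain ⟨a, ha, hay⟩ := hy
      obtain ⟨c', hc'⟩ := hd c
      refine ⟨c' * a, Ideal.mul_mem_left _ _ ha, ?_⟩
      have h1 : ι a ∈ maximalIdeal T ^ n := by
        rw [← hmap, ← Ideal.map_pow]
        exact Ideal.mem_map_of_mem ι ha
      have h2 := add_mem (Ideal.mul_mem_left _ c hay) (Ideal.mul_mem_mul h1 hc')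
      convert h2 using 1
      rw [map_mul, smul_eq_mul]
      ring
  induction n with
  | zero => exact ⟨0, by simp⟩
  | succ n ih =>
    obtain ⟨a, ha⟩ := ih
    rw [← hmap, ← Ideal.map_pow] at ha
    obtain ⟨b, -, hb⟩ := key n _ ha
    refine ⟨a - b, ?_⟩
    rw [← neg_mem_iff]
    convert hb using 1
    rw [map_sub]
    ring

end Contraction

namespace IsRegularSubring

variable {T : Type*} [CommRing T]

/-- Membership in an extended ideal involves only finitely many generators, so descent for finite
sets suffices. -/
theorem comap_map_eq {A : Subring T}
    (hA : ∀ s : Finset T, (s : Set T) ⊆ A →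
      ∀ c ∈ A, c ∈ Ideal.span (s : Set T) → c ∈ Submodule.span A (s : Set T)) (I : Ideal A) :
    (I.map A.subtype).comap A.subtype = I := by
  refine le_antisymm (fun x hx ↦ ?_) Ideal.le_comap_map
  obtain ⟨F, hF, hxF⟩ := Submodule.mem_span_finite_of_mem_span hx
  have h := hA F (fun y hy ↦ by
    obtain ⟨z, -, rfl⟩ := hF hy
    exact z.2) _ x.2 hxF
  have hle : Submodule.span A (F : Set T) ≤ Submodule.map (Algebra.linearMap A T) I :=
    Submodule.span_le.2 hF
  obtain ⟨z, hz, hzx⟩ := hle h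
  rwa [← Subtype.ext hzx]

theorem bot (h : ∀ n : ℤ, (n : T) ≠ 0 → (n : T) ∈ nonZeroDivisors T) :
    IsRegularSubring (⊥ : Subring T) where
  countable := by
    rw [Subring.coe_bot]
    exact Set.countable_range _
  mem_nonZeroDivisors x hx hx0 := by
    obtain ⟨n, rfl⟩ := Subring.mem_bot.1 hx
    exact h n hx0

theorem isDomain [Nontrivial T] {A : Subring T} (hA : IsRegularSubring A) : IsDomain A :=
  have : NoZeroDivisors A := ⟨fun {a b} hab ↦ by
    by_contra! h
    have ha := hA.mem_nonZeroDivisors a a.2 (by simpa using h.1)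
    exact h.2 (Subtype.ext ((mem_nonZeroDivisors_iff.1 ha).1 _ (congrArg Subtype.val hab)))⟩
  NoZeroDivisors.to_isDomain A

end IsRegularSubring

/-! ### Construction of the domain and conclusion -/

/-- The existence part: a complete local ring satisfying the three conditions, and which is not a
field, contains a countable local domain of which it is the completion. -/
theorem exists_subring_adicCompletion_equiv {T : Type*} [CommRing T] [IsLocalRing T]
    [IsNoetherianRing T] [IsAdicComplete (maximalIdeal T) T]
    (hint : ∀ n : ℤ, (n : T) ≠ 0 → (n : T) ∈ nonZeroDivisors T)
    (hM : maximalIdeal T ∉ associatedPrimes T T) [Countable (T ⧸ maximalIdeal T)] :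
    ∃ (A : Subring T) (_ : IsLocalRing A), IsNoetherianRing A ∧ IsDomain A ∧ Countable A ∧
      Nonempty (AdicCompletion (maximalIdeal A) A ≃+* T) := by
  obtain ⟨G, hG⟩ := (isNoetherianRing_iff_ideal_fg T).1 ‹_› (maximalIdeal T)
  -- Modulo `M` is enough for residue classes; modulo `M ^ 2` is what Nakayama needs for generators
  -- of `M`.
  let p : T → Subring T → Prop := fun t S ↦ ∃ x ∈ S, x - t ∈ maximalIdeal T ^ 2
  obtain ⟨R, -, hR, hRp⟩ := (IsRegularSubring.bot hint).exists_forall_of_countable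
    (ι := (T ⧸ maximalIdeal T) ⊕ G) (fun i ↦ p (i.elim Quotient.out Subtype.val))
    (fun i S S' hle ⟨x, hx, hxt⟩ ↦ ⟨x, hle hx, hxt⟩) (fun i S _ hS ↦ by
      obtain ⟨a, ha, hSa⟩ := hS.exists_adjoin hM (i.elim Quotient.out Subtype.val)
        (one_mem (nonZeroDivisors T)) 2
      exact ⟨_, IsRegularSubring.le_adjoin S _, hSa, _, IsRegularSubring.self_mem_adjoin S _,
        by simpa using ha⟩)
  obtain ⟨A, hRA, hA, hspan⟩ := hR.exists_span_closed hM
  have hcomap := IsRegularSubring.comap_map_eq hspan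
  have : IsLocalHom A.subtype := isLocalHom_of_comap_map_eq hcomap
  have hloc : IsLocalRing A := RingHom.domain_isLocalRing A.subtype
  have hmax : (maximalIdeal T).comap A.subtype = maximalIdeal A :=
    ((local_hom_TFAE A.subtype).out 0 4).1 this
  have hmap : (maximalIdeal A).map A.subtype = maximalIdeal T := by
    refine le_antisymm (Ideal.map_le_iff_le_comap.2 hmax.ge) ?_
    refine Submodule.le_of_le_smul_of_le_jacobson_bot (I := maximalIdeal T)
      (IsNoetherian.noetherian _) (maximalIdeal_le_jacobson _) ?_
    conv_lhs => rw [← hG]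
    refine Ideal.span_le.2 fun g hg ↦ ?_
    obtain ⟨x, hx, hxg⟩ := hRp (Sum.inr ⟨g, hg⟩)
    have hgM : g ∈ maximalIdeal T := hG ▸ Ideal.subset_span hg
    have hxM : x ∈ maximalIdeal T := by
      simpa using add_mem (Ideal.pow_le_self two_ne_zero hxg) hgM
    refine Submodule.mem_sup.2 ⟨x, ?_, g - x, ?_, by ring⟩
    · exact Ideal.mem_map_of_mem A.subtype (x := ⟨x, hRA hx⟩) (hmax.le hxM)
    · rw [smul_eq_mul, ← pow_two, ← neg_mem_iff, neg_sub]
      exact hxg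
  have hdense : ∀ t, ∃ a, A.subtype a - t ∈ maximalIdeal T := fun t ↦ by
    obtain ⟨x, hx, hxt⟩ := hRp (Sum.inl (Ideal.Quotient.mk _ t))
    refine ⟨⟨x, hRA hx⟩, ?_⟩
    have h : Quotient.out (Ideal.Quotient.mk (maximalIdeal T) t) - t ∈ maximalIdeal T :=
      Ideal.Quotient.eq.1 (Quotient.out_eq _)
    simpa using add_mem (Ideal.pow_le_self two_ne_zero hxt) h
  refine ⟨A, hloc, isNoetherianRing_of_comap_map_eq hcomap, hA.isDomain,
    hA.countable.to_subtype, nonempty_adicCompletion_equiv A.subtype _ (maximalIdeal T)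
      (fun n ↦ ?_) (exists_sub_mem_maximalIdeal_pow hmap hdense)⟩
  -- The induced topology is the `m_A`-adic one: `M ^ n = m_A ^ n T` contracts to `m_A ^ n`.
  rw [← hmap, ← Ideal.map_pow, hcomap]

theorem corollary2p15 (T : Type u) [CommRing T] [IsLocalRing T] [IsNoetherianRing T]
    [IsAdicComplete (IsLocalRing.maximalIdeal T) T] :
    (∃ (A : Type u) (_ : CommRing A) (_ : IsLocalRing A),
        IsNoetherianRing A ∧ IsDomain A ∧ Countable A ∧
          Nonempty (AdicCompletion (IsLocalRing.maximalIdeal A) A ≃+* T)) ↔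
      (∀ n : ℤ, (n : T) ≠ 0 → (n : T) ∈ nonZeroDivisors T) ∧
        (IsLocalRing.maximalIdeal T ≠ ⊥ →
          IsLocalRing.maximalIdeal T ∉ associatedPrimes T T) ∧
        Countable (T ⧸ IsLocalRing.maximalIdeal T) := by
  constructor
  · rintro ⟨A, _, _, _, _, _, ⟨e⟩⟩
    exact conditions_of_adicCompletion_equiv e
  · rintro ⟨hint, hM, hcount⟩
    by_cases h : maximalIdeal T = ⊥
    · have hcT : Countable T := by
        have hinj : Function.Injective (Ideal.Quotient.mk (maximalIdeal T)) :=
          ((Ideal.Quotient.mk_bijective_iff_eq_bot _).2 h).1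
        exact hinj.countable
      have hdom : IsDomain T := (IsLocalRing.isField_iff_maximalIdeal_eq.2 h).isDomain
      exact ⟨T, _, ‹_›, ‹_›, hdom, hcT,
        ⟨(AdicCompletion.ofAlgEquiv (maximalIdeal T)).symm.toRingEquiv⟩⟩
    · obtain ⟨A, hloc, hA⟩ := exists_subring_adicCompletion_equiv hint (hM h)
      exact ⟨A, _, hloc, hA⟩
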